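/- Let $n\in\mathbb N$ and let $\Delta_n=\{p\in\mathbb R^n : p_i\ge 0 \text{ for all } i,\ \sum_{i=1}^n p_i=1\}$ be the probability simplex with its Euclidean topology. Let $\mathcal S:\Delta_n\times\Delta_n\to\mathbb R$ be a $C^\infty$ function, where $C^\infty$ is understood on the closed set $\Delta_n\times\Delta_n$, up to and including its boundary. Then $\mathcal S$ is a Structure Encoding Loss Function (SELF), that is: there exist a separable real Hilbert space $\mathcal H$ with inner product $\langle\cdot,\cdot\rangle_{\mathcal H}$, a continuous map $\psi:\Delta_n\to\mathcal H$ and a bounded linear operator $V:\mathcal H\to\mathcal H$ such that $$\mathcal S(y,y')=\langle \psi(y),V\psi(y')\rangle_{\mathcal H}\qquad\text{for all } y,y'\in\Delta_n .$$ -/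

import Mathlib

open scoped ContDiff

/-- A function `S : Y × Y → ℝ` on a topological space `Y` is a *Structure Encoding Loss Function*
if there are a separable (real) Hilbert space `H`, a continuous map `ψ : Y → H` and a bounded linear
operator `V : H → H` with `S (y, y') = ⟪ψ y, V (ψ y')⟫` for all `y, y'`. Every separable Hilbert
space is isometric to one living in `Type`, so the universe of `H` is no restriction. -/
def IsSELF {Y : Type*} [TopologicalSpace Y] (S : Y × Y → ℝ) : Prop :=
  ∃ (H : Type) (_ : NormedAddCommGroup H) (_ : InnerProductSpace ℝ H) (_ : CompleteSpace H)
    (_ : TopologicalSpace.SeparableSpace H) (ψ : Y → H) (V : H →L[ℝ] H),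
    Continuous ψ ∧ ∀ y y' : Y, S (y, y') = inner ℝ (ψ y) (V (ψ y'))

/-- `S ∈ C^∞(Δ_n × Δ_n)`: the function `S`, regarded as a function on the subset `Δ_n × Δ_n` of
`ℝⁿ × ℝⁿ`, is `C^∞` on that subset, up to and including the boundary. The function `F` only carries
the values of `S` on `Δ_n × Δ_n`: `ContDiffOn` does not depend on its values elsewhere, and `F` is
not required to be smooth, or even continuous, off `Δ_n × Δ_n`. -/
def IsSmoothOnSimplexProd {n : ℕ}
    (S : stdSimplex ℝ (Fin n) × stdSimplex ℝ (Fin n) → ℝ) : Prop :=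
  ∃ F : (Fin n → ℝ) × (Fin n → ℝ) → ℝ,
    (∀ y y' : stdSimplex ℝ (Fin n), F ((y : Fin n → ℝ), (y' : Fin n → ℝ)) = S (y, y')) ∧
    ContDiffOn ℝ ∞ F (stdSimplex ℝ (Fin n) ×ˢ stdSimplex ℝ (Fin n))

/-! # Smooth functions on products of simplices factor through a Hilbert space

A function `K : X → T → ℝ` is called Hilbert factorizable here if `K x t = ⟪ψ x, φ t⟫` for continuous
maps `ψ`, `φ` into one separable Hilbert space `H`. Applied to `X = T = Y`, this gives the SELF
property: on `H ⊕ H` take `y ↦ (ψ y, φ y)` and let `V` send `(a, b)` to `(b, 0)`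
(`IsSELF.of_hasHilbertFactorization`).

The factorization is first found on a cube. In one variable, the formula
`G (x, τ) = G (x, 0) + ∫ u in 0..1, 1_{u ≤ τ} ∂_τ G (x, u)`
displays `G` as a constant term plus an `L²` inner product of `u ↦ ∂_τ G (x, u)`, which depends
continuously on `x`, with the indicator of `[0, τ]`, which depends continuously on `τ`. Iterating
over the coordinates, with values in a Hilbert space, settles every smooth `G` on `E × [0,1]^d`
(`HasHilbertFactorization.integral_Iic`, `hasHilbertFactorization_of_contDiff`).

To pass to the simplex, boundary included, no extension theorem is used. The stick-breaking map,
built from a smooth step function, is smooth on all of `ℝ^m`, takes values in the simplex, and maps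
`[0,1]^m` onto it, so `S` pulls back to a smooth function on the whole space. The factorization then
descends to the simplex: after projecting `ψ` onto the closed span of the values of `φ`, the vector
`ψ x` is determined by the function `⟪ψ x, φ ·⟫`, hence is constant on the fibres of the
parametrization (`HasHilbertFactorization.of_quotient_left`).
-/

open Set Filter Topology MeasureTheory

/-! ### Hilbert space factorizations -/

/-- `K : X → T → ℝ` is the pairing `⟪ψ x, φ t⟫` of continuous maps `ψ` and `φ` into a common
separable real Hilbert space. -/
def HasHilbertFactorization {X T : Type*} [TopologicalSpace X] [TopologicalSpace T]
    (K : X → T → ℝ) : Prop :=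
  ∃ (H : Type) (_ : NormedAddCommGroup H) (_ : InnerProductSpace ℝ H) (_ : CompleteSpace H)
    (_ : TopologicalSpace.SeparableSpace H) (ψ : X → H) (φ : T → H),
    Continuous ψ ∧ Continuous φ ∧ ∀ x t, K x t = inner ℝ (ψ x) (φ t)

theorem HasHilbertFactorization.of_continuous_left {X T : Type*} [TopologicalSpace X]
    [TopologicalSpace T] {f : X → ℝ} (hf : Continuous f) :
    HasHilbertFactorization (fun x (_ : T) => f x) :=
  ⟨ℝ, inferInstance, inferInstance, inferInstance, inferInstance, f, fun _ => 1, hf,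
    continuous_const, fun x t => by simp⟩

theorem HasHilbertFactorization.flip {X T : Type*} [TopologicalSpace X] [TopologicalSpace T]
    {K : X → T → ℝ} (h : HasHilbertFactorization K) :
    HasHilbertFactorization (fun t x => K x t) := by
  obtain ⟨H, i1, i2, i3, i4, ψ, φ, hψ, hφ, hK⟩ := h
  exact ⟨H, i1, i2, i3, i4, φ, ψ, hφ, hψ, fun t x => (hK x t).trans (real_inner_comm _ _)⟩

theorem HasHilbertFactorization.comp {X T X' T' : Type*} [TopologicalSpace X] [TopologicalSpace T]
    [TopologicalSpace X'] [TopologicalSpace T'] {K : X → T → ℝ} (h : HasHilbertFactorization K)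
    {f : X' → X} {g : T' → T} (hf : Continuous f) (hg : Continuous g) :
    HasHilbertFactorization (fun x t => K (f x) (g t)) := by
  obtain ⟨H, i1, i2, i3, i4, ψ, φ, hψ, hφ, hK⟩ := h
  exact ⟨H, i1, i2, i3, i4, ψ ∘ f, φ ∘ g, hψ.comp hf, hφ.comp hg, fun _ _ => hK _ _⟩

/-- Sums are factorized through the orthogonal direct sum. -/
theorem HasHilbertFactorization.add {X T : Type*} [TopologicalSpace X] [TopologicalSpace T]
    {K L : X → T → ℝ} (hK : HasHilbertFactorization K) (hL : HasHilbertFactorization L) :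
    HasHilbertFactorization (fun x t => K x t + L x t) := by
  obtain ⟨H, i1, i2, i3, i4, ψ, φ, hψ, hφ, hK⟩ := hK
  obtain ⟨H', i1', i2', i3', i4', ψ', φ', hψ', hφ', hL⟩ := hL
  have := UniformSpace.secondCountable_of_separable H
  have := UniformSpace.secondCountable_of_separable H'
  refine ⟨WithLp 2 (H × H'), inferInstance, inferInstance, inferInstance, inferInstance,
    fun x => WithLp.toLp 2 (ψ x, ψ' x), fun t => WithLp.toLp 2 (φ t, φ' t), ?_, ?_, ?_⟩
  · exact (WithLp.prod_continuous_toLp 2 H H').comp (hψ.prodMk hψ')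
  · exact (WithLp.prod_continuous_toLp 2 H H').comp (hφ.prodMk hφ')
  · intro x t
    simp [WithLp.prod_inner_apply, hK, hL]

theorem IsSELF.of_hasHilbertFactorization {Y : Type*} [TopologicalSpace Y] {S : Y × Y → ℝ}
    (h : HasHilbertFactorization (fun y y' => S (y, y'))) : IsSELF S := by
  obtain ⟨H, i1, i2, i3, i4, ψ, φ, hψ, hφ, hS⟩ := h
  have := UniformSpace.secondCountable_of_separable H
  let e := WithLp.prodContinuousLinearEquiv 2 ℝ H H
  refine ⟨WithLp 2 (H × H), inferInstance, inferInstance, inferInstance, inferInstance,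
    fun y => WithLp.toLp 2 (ψ y, φ y),
    e.symm.toContinuousLinearMap ∘L
      (ContinuousLinearMap.inl ℝ H H ∘L ContinuousLinearMap.snd ℝ H H) ∘L
      e.toContinuousLinearMap, ?_, ?_⟩
  · exact (WithLp.prod_continuous_toLp 2 H H).comp (hψ.prodMk hφ)
  · intro y y'
    simp [WithLp.prod_inner_apply, hS, e]

/-- Factorizations descend along quotient maps. Replacing `ψ` by its projection to the closed span
of the values of `φ` does not change the pairing, and makes `ψ x` depend only on `⟪ψ x, φ ·⟫`. -/
theorem HasHilbertFactorization.of_quotient_left {X X' T : Type*} [TopologicalSpace X]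
    [TopologicalSpace X'] [TopologicalSpace T] {p : X → X'} (hp : IsQuotientMap p)
    {K : X' → T → ℝ} (h : HasHilbertFactorization (fun x t => K (p x) t)) :
    HasHilbertFactorization K := by
  obtain ⟨H, i1, i2, i3, i4, ψ, φ, hψ, hφ, hK⟩ := h
  replace hK : ∀ x t, K (p x) t = inner ℝ (ψ x) (φ t) := hK
  let M : Submodule ℝ H := (Submodule.span ℝ (range φ)).topologicalClosure
  have : CompleteSpace M := (Submodule.isClosed_topologicalClosure _).completeSpace_coe
  have hmem : ∀ t, φ t ∈ M := fun t =>
    Submodule.le_topologicalClosure _ (Submodule.subset_span (mem_range_self t))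
  have hcont : Continuous fun x => M.starProjection (ψ x) :=
    M.starProjection.continuous.comp hψ
  have hfib : ∀ x x', p x = p x' → M.starProjection (ψ x) = M.starProjection (ψ x') := by
    intro x x' hxx
    rw [← sub_eq_zero, ← map_sub, Submodule.starProjection_apply_eq_zero_iff,
      Submodule.orthogonal_closure, Submodule.mem_orthogonal']
    intro u hu
    induction hu using Submodule.span_induction with
    | mem u hu =>
      obtain ⟨t, rfl⟩ := hu
      rw [inner_sub_left, ← hK, ← hK, hxx, sub_self]
    | zero => simp
    | add u v _ _ hu hv => rw [inner_add_right, hu, hv, add_zero]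
    | smul c u _ hu => rw [inner_smul_right, hu, mul_zero]
  refine ⟨H, i1, i2, i3, i4, fun x' => M.starProjection (ψ (Function.surjInv hp.surjective x')), φ,
    ?_, hφ, ?_⟩
  · rw [hp.continuous_iff]
    refine hcont.congr fun x => hfib _ _ ?_
    exact (Function.surjInv_eq hp.surjective (p x)).symm
  · intro x' t
    rw [Submodule.inner_starProjection_left_eq_right,
      Submodule.starProjection_eq_self_iff.mpr (hmem t), ← hK,
      Function.surjInv_eq hp.surjective]

theorem HasHilbertFactorization.of_quotient {X Y : Type*} [TopologicalSpace X] [TopologicalSpace Y]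
    {p : X → Y} (hp : IsQuotientMap p) {K : Y → Y → ℝ}
    (h : HasHilbertFactorization (fun x x' => K (p x) (p x'))) : HasHilbertFactorization K :=
  (of_quotient_left hp (of_quotient_left hp h.flip).flip)

/-! ### Smooth functions on a cube -/

theorem continuous_indicatorConstLp_Iic {H : Type*} [NormedAddCommGroup H] :
    Continuous fun q : unitInterval × H =>
      indicatorConstLp 2 (μ := (volume : Measure unitInterval)) (measurableSet_Iic (a := q.1))
        (measure_ne_top _ _) q.2 := by
  have hset : ∀ c : H, Continuous fun τ : unitInterval =>
      indicatorConstLp 2 (μ := (volume : Measure unitInterval)) (measurableSet_Iic (a := τ))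
        (measure_ne_top _ _) c := by
    intro c
    refine continuous_indicatorConstLp_set (by simp) fun τ => ?_
    have hle : ∀ σ : unitInterval,
        (volume : Measure unitInterval) (symmDiff (Iic σ) (Iic τ)) ≤ edist τ σ := by
      intro σ
      rw [← unitInterval.volume_uIoc]
      refine measure_mono fun u hu => ?_
      simp only [mem_symmDiff, mem_Iic, mem_uIoc, not_le] at hu ⊢
      tauto
    refine tendsto_of_tendsto_of_tendsto_of_le_of_le tendsto_const_nhds ?_
      (fun _ => zero_le) hle
    have : Continuous fun σ : unitInterval => edist τ σ := by fun_prop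
    simpa using this.tendsto τ
  rw [continuous_iff_continuousAt]
  rintro ⟨τ₀, c₀⟩
  -- Split off the change of the vector, which is controlled uniformly in the interval.
  have h2 : Tendsto (fun q : unitInterval × H =>
      indicatorConstLp 2 (μ := (volume : Measure unitInterval)) (measurableSet_Iic (a := q.1))
        (measure_ne_top _ _) (q.2 - c₀)) (𝓝 (τ₀, c₀)) (𝓝 0) := by
    refine squeeze_zero_norm (a := fun q => ‖q.2 - c₀‖) (fun q => ?_) ?_
    · refine norm_indicatorConstLp_le.trans (mul_le_of_le_one_right (norm_nonneg _) ?_)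
      exact Real.rpow_le_one measureReal_nonneg measureReal_le_one (by simp)
    · have : Continuous fun q : unitInterval × H => ‖q.2 - c₀‖ := by fun_prop
      simpa using this.tendsto (τ₀, c₀)
  have h1 := ((hset c₀).comp continuous_fst).tendsto (τ₀, c₀)
  simpa [indicatorConstLp_add, ContinuousAt] using h1.add h2

theorem setIntegral_unitInterval_Iic (f : ℝ → ℝ) (τ : unitInterval) :
    ∫ u in Iic τ, f u = ∫ u in (0 : ℝ)..τ, f u := by
  have hpre : Iic τ = ((↑) : unitInterval → ℝ) ⁻¹' Iic (τ : ℝ) := rfl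
  rw [hpre, unitInterval.measurePreserving_coe.setIntegral_preimage_emb
    unitInterval.measurableEmbedding_coe, Measure.restrict_restrict measurableSet_Iic,
    intervalIntegral.integral_of_le τ.2.1, ← integral_Icc_eq_integral_Ioc]
  congr 2
  ext u
  have := τ.2.2
  simp only [mem_inter_iff, mem_Iic, mem_Icc]
  grind

/-- Integrating out a variable over `[0, τ]` preserves factorizability: a factorization
`⟪ψ (x, u), φ t⟫` of the integrand turns into the pairing of `u ↦ ψ (x, u)` with
`u ↦ 1_{u ≤ τ} • φ t` in `L²([0, 1], H)`. -/
theorem HasHilbertFactorization.integral_Iic {X T : Type*} [TopologicalSpace X]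
    [TopologicalSpace T] {K : X × unitInterval → T → ℝ} (h : HasHilbertFactorization K) :
    HasHilbertFactorization (fun x (q : unitInterval × T) => ∫ u in Iic q.1, K (x, u) q.2) := by
  obtain ⟨H, i1, i2, i3, i4, ψ, φ, hψ, hφ, hK⟩ := h
  let Ψ : C(X, C(unitInterval, H)) := ContinuousMap.curry ⟨ψ, hψ⟩
  have : Fact ((2 : ENNReal) ≠ ⊤) := ⟨by simp⟩
  refine ⟨Lp H 2 (volume : Measure unitInterval), inferInstance, inferInstance, inferInstance,
    inferInstance, fun x => ContinuousMap.toLp 2 volume ℝ (Ψ x),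
    fun q => indicatorConstLp 2 (measurableSet_Iic (a := q.1)) (measure_ne_top _ _) (φ q.2),
    ?_, ?_, ?_⟩
  · exact (ContinuousMap.toLp 2 volume ℝ).continuous.comp Ψ.continuous
  · exact continuous_indicatorConstLp_Iic.comp
      (continuous_fst.prodMk (hφ.comp continuous_snd))
  · intro x q
    rw [real_inner_comm, L2.inner_indicatorConstLp_eq_setIntegral_inner]
    refine integral_congr_ae (ae_restrict_of_ae ?_)
    filter_upwards [ContinuousMap.coeFn_toLp (p := 2) (𝕜 := ℝ) volume (Ψ x)] with u hu
    rw [hu, hK, real_inner_comm]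
    rfl

theorem contDiff_finCons {d : ℕ} {E : Type*} [NormedAddCommGroup E] [NormedSpace ℝ E]
    {f : E → ℝ} {g : E → Fin d → ℝ} (hf : ContDiff ℝ ∞ f) (hg : ContDiff ℝ ∞ g) :
    ContDiff ℝ ∞ fun x => (Fin.cons (f x) (g x) : Fin (d + 1) → ℝ) := by
  rw [contDiff_pi]
  intro i
  cases i using Fin.cases with
  | zero => simpa using hf
  | succ i => simpa using contDiff_pi.mp hg i

/-- A smooth function on `E × ℝ^d` is Hilbert factorizable on `E × [0, 1]^d`: one coordinate at a
time, it is the sum of its value at `0` and the integral of its derivative. The parameter space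
`E` is arbitrary because the integration variable joins it in the induction. -/
theorem hasHilbertFactorization_of_contDiff (d : ℕ) :
    ∀ {E : Type} [NormedAddCommGroup E] [NormedSpace ℝ E] {G : E × (Fin d → ℝ) → ℝ},
      ContDiff ℝ ∞ G →
      HasHilbertFactorization (fun (x : E) (t : Fin d → unitInterval) => G (x, fun i => t i)) := by
  induction d with
  | zero =>
    intro E _ _ G hG
    convert HasHilbertFactorization.of_continuous_left (T := Fin 0 → unitInterval)
      (f := fun x => G (x, 0)) (hG.continuous.comp (by fun_prop)) using 5
  | succ d ih =>
    intro E _ _ G hG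
    let v : E × (Fin (d + 1) → ℝ) := (0, Fin.cons 1 0)
    let G₀ : E × (Fin d → ℝ) → ℝ := fun q => G (q.1, Fin.cons 0 q.2)
    let G₁ : (E × ℝ) × (Fin d → ℝ) → ℝ := fun q => fderiv ℝ G (q.1.1, Fin.cons q.1.2 q.2) v
    have hG₀ : ContDiff ℝ ∞ G₀ :=
      hG.comp (contDiff_fst.prodMk (contDiff_finCons contDiff_const contDiff_snd))
    have hG₁ : ContDiff ℝ ∞ G₁ := by
      refine ContDiff.clm_apply ((hG.fderiv_right (m := ∞) (by simp)).comp ?_) contDiff_const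
      exact (contDiff_fst.comp contDiff_fst).prodMk
        (contDiff_finCons (contDiff_snd.comp contDiff_fst) contDiff_snd)
    have h₁ := ((ih hG₁).comp (f := fun q : E × unitInterval => (q.1, (q.2 : ℝ)))
      (by fun_prop) continuous_id).integral_Iic
    have hcoord : Continuous fun t : Fin (d + 1) → unitInterval => (t 0, Fin.tail t) := by
      unfold Fin.tail; fun_prop
    convert ((ih hG₀).comp continuous_id (continuous_snd.comp hcoord)).add
      (h₁.comp continuous_id hcoord) using 3 with x t
    have hderiv : ∀ u : ℝ, HasDerivAt
        (fun u => G (x, Fin.cons u fun i => (Fin.tail t i : ℝ)))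
        (G₁ ((x, u), fun i => (Fin.tail t i : ℝ))) u := by
      intro u
      have hline : HasDerivAt
          (fun u : ℝ => (x, (Fin.cons u fun i => (Fin.tail t i : ℝ) : Fin (d + 1) → ℝ))) v u := by
        refine (hasDerivAt_const u x).prodMk (hasDerivAt_pi.mpr fun i => ?_)
        cases i using Fin.cases with
        | zero => simpa using hasDerivAt_id' u
        | succ i => simpa using hasDerivAt_const u _
      exact ((hG.differentiable (by simp)).differentiableAt.hasFDerivAt).comp_hasDerivAt u hline
    have hint := intervalIntegral.integral_eq_sub_of_hasDerivAt (a := 0) (b := (t 0 : ℝ))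
      (fun u _ => hderiv u) (Continuous.intervalIntegrable
        (hG₁.continuous.comp (by fun_prop)) _ _)
    simp only [Function.comp_apply, id]
    rw [setIntegral_unitInterval_Iic (fun u => G₁ ((x, u), fun i => (Fin.tail t i : ℝ))), hint,
      add_sub_cancel]
    congr 2
    ext i
    cases i using Fin.cases <;> rfl

/-! ### The stick-breaking parametrization of the simplex -/

/-- Stick breaking: the first coordinate is the fraction of the unit stick given by the smooth step
function at `t 0`, and the rest of the stick is broken up recursively. -/
noncomputable def stickBreaking : (m : ℕ) → (Fin m → ℝ) → Fin (m + 1) → ℝ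
  | 0, _ => fun _ => 1
  | m + 1, t => Fin.cons (Real.smoothTransition (t 0))
      ((1 - Real.smoothTransition (t 0)) • stickBreaking m (Fin.tail t))

theorem contDiff_stickBreaking (m : ℕ) : ContDiff ℝ ∞ (stickBreaking m) := by
  induction m with
  | zero => exact contDiff_const
  | succ m ih =>
    have h0 : ContDiff ℝ ∞ fun t : Fin (m + 1) → ℝ => Real.smoothTransition (t 0) :=
      Real.smoothTransition.contDiff.comp (contDiff_apply ℝ ℝ 0)
    refine contDiff_finCons h0 ((contDiff_const.sub h0).smul (ih.comp ?_))
    exact contDiff_pi.mpr fun i => contDiff_apply ℝ ℝ i.succ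

theorem stickBreaking_mem (m : ℕ) (t : Fin m → ℝ) :
    stickBreaking m t ∈ stdSimplex ℝ (Fin (m + 1)) := by
  induction m with
  | zero => simp [stickBreaking, stdSimplex]
  | succ m ih =>
    obtain ⟨hpos, hsum⟩ := ih (Fin.tail t)
    refine ⟨fun i => ?_, ?_⟩
    · cases i using Fin.cases with
      | zero => exact Real.smoothTransition.nonneg _
      | succ i =>
        exact mul_nonneg (sub_nonneg.mpr (Real.smoothTransition.le_one _)) (hpos i)
    · rw [Fin.sum_univ_succ]
      simp [stickBreaking, ← Finset.mul_sum, hsum]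

theorem exists_unitInterval_smoothTransition_eq {a : ℝ} (h0 : 0 ≤ a) (h1 : a ≤ 1) :
    ∃ τ : unitInterval, Real.smoothTransition τ = a := by
  obtain ⟨τ, hτ, h⟩ := intermediate_value_Icc zero_le_one
    Real.smoothTransition.continuous.continuousOn
    (show a ∈ Icc (Real.smoothTransition 0) (Real.smoothTransition 1) by simp [h0, h1])
  exact ⟨⟨τ, hτ⟩, h⟩

theorem exists_stickBreaking_eq (m : ℕ) {p : Fin (m + 1) → ℝ}
    (hp : p ∈ stdSimplex ℝ (Fin (m + 1))) :
    ∃ t : Fin m → unitInterval, stickBreaking m (fun i => t i) = p := by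
  induction m with
  | zero =>
    refine ⟨fun _ => 0, funext fun i => ?_⟩
    have hsum : p 0 = 1 := by simpa using hp.2
    rw [Fin.fin_one_eq_zero i, hsum]
    rfl
  | succ m ih =>
    obtain ⟨hpos, hsum⟩ := hp
    rw [Fin.sum_univ_succ] at hsum
    have htail : 0 ≤ ∑ i : Fin (m + 1), p i.succ := Finset.sum_nonneg fun i _ => hpos _
    obtain ⟨τ, hτ⟩ := exists_unitInterval_smoothTransition_eq (hpos 0) (by linarith)
    have key : ∃ t : Fin m → unitInterval, ∀ i, (1 - p 0) * stickBreaking m (fun i => t i) i =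
        p (Fin.succ i) := by
      rcases htail.eq_or_lt with h | h
      · -- Nothing is left of the stick, so the remaining parameters are arbitrary.
        refine ⟨fun _ => 0, fun i => ?_⟩
        have hi := (Finset.sum_eq_zero_iff_of_nonneg fun i _ => hpos (Fin.succ i)).mp h.symm i
          (Finset.mem_univ i)
        rw [hi, show 1 - p 0 = 0 by linarith, zero_mul]
      · have hne : 1 - p 0 ≠ 0 := by linarith
        obtain ⟨t, ht⟩ := ih (p := fun i => (1 - p 0)⁻¹ * p i.succ)
          ⟨fun i => mul_nonneg (inv_nonneg.mpr (by linarith)) (hpos _), by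
            rw [← Finset.mul_sum, show ∑ i : Fin (m + 1), p i.succ = 1 - p 0 by linarith,
              inv_mul_cancel₀ hne]⟩
        exact ⟨t, fun i => by rw [ht, mul_inv_cancel_left₀ hne]⟩
    obtain ⟨t, ht⟩ := key
    refine ⟨Fin.cons τ t, funext fun i => ?_⟩
    cases i using Fin.cases with
    | zero => simpa [stickBreaking] using hτ
    | succ i =>
      have h : stickBreaking (m + 1) (fun j => (Fin.cons τ t : Fin (m + 1) → unitInterval) j)
          i.succ = (1 - Real.smoothTransition τ) * stickBreaking m (fun j => t j) i := rfl
      rw [h, hτ, ht]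

/-! ### Smooth functions on products of simplices -/

theorem mainTheorem5 (n : ℕ)
    (S : stdSimplex ℝ (Fin n) × stdSimplex ℝ (Fin n) → ℝ)
    (hS : IsSmoothOnSimplexProd S) :
    IsSELF S := by
  obtain ⟨F, hFS, hF⟩ := hS
  refine IsSELF.of_hasHilbertFactorization ?_
  cases n with
  | zero =>
    -- The simplex with no vertices is empty.
    have hempty : IsEmpty (stdSimplex ℝ (Fin 0)) := ⟨fun y => by simpa using y.2.2⟩
    exact ⟨ℝ, inferInstance, inferInstance, inferInstance, inferInstance, fun _ => 0, fun _ => 0,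
      continuous_const, continuous_const, fun y => isEmptyElim y⟩
  | succ m =>
    let p : (Fin m → unitInterval) → stdSimplex ℝ (Fin (m + 1)) :=
      fun t => ⟨stickBreaking m (fun i => t i), stickBreaking_mem m _⟩
    have hcoe : Continuous fun (t : Fin m → unitInterval) (i : Fin m) => (t i : ℝ) := by fun_prop
    have hpc : Continuous p :=
      ((contDiff_stickBreaking m).continuous.comp hcoe).subtype_mk _
    have hps : Function.Surjective p := fun y =>
      (exists_stickBreaking_eq m y.2).imp fun t ht => Subtype.ext ht
    have hG : ContDiff ℝ ∞ fun q : (Fin m → ℝ) × (Fin m → ℝ) =>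
        F (stickBreaking m q.1, stickBreaking m q.2) := by
      -- The simplex is not a set of unique differentiability, but the chain rule for
      -- `ContDiffOn` does not need that, and the composite is smooth on the whole space.
      rw [← contDiffOn_univ]
      refine hF.comp (((contDiff_stickBreaking m).prodMap
        (contDiff_stickBreaking m)).contDiffOn) fun q _ => ?_
      exact ⟨stickBreaking_mem m _, stickBreaking_mem m _⟩
    refine HasHilbertFactorization.of_quotient (IsQuotientMap.of_surjective_continuous hps hpc) ?_
    convert (hasHilbertFactorization_of_contDiff m hG).comp hcoe continuous_id using 3 with s t
    exact (hFS (p s) (p t)).symm
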